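/- Let $n\ge 2$ and $\mathcal N=\{1,\dots,n\}$. For $i,j\in\mathcal N$ let $a_{ij}:\mathbb R^+\to\mathbb R^+$ be measurable and integrable on bounded intervals. A \emph{trajectory} is a locally absolutely continuous $x:\mathbb R^+\to\mathbb R^n$ such that, for all $t\ge 0$ and $i\in\mathcal N$, $$x_i(t)=x_i(0)+\int_0^t\sum_{j=1}^n a_{ij}(s)\,(x_j(s)-x_i(s))\,ds .$$ Its diameter is $\Delta(t)=\max_{i} x_i(t)-\min_{j} x_j(t)$. Assume: (1) (Persistent connectivity) the directed graph on $\mathcal N$ with edge set $\{(j,i):\int_0^{\infty}a_{ij}(s)\,ds=+\infty\}$ is strongly connected; (2) (Cut-balanced weights) $K\ge 1$ is a real number such that for every non-empty proper subset $S\subsetneq\mathcal N$ and every $t\ge 0$, $$K^{-1}\sum_{i\in S,\,j\notin S}a_{ji}(t)\le\sum_{i\in S,\,j\notin S}a_{ij}(t)\le K\sum_{i\in S,\,j\notin S}a_{ji}(t).$$ Define $t_0=0$ and, for $p\in\mathbb N$, $t_p^0=t_p$; for $0\le q<\lfloor n/2\rfloor$ let $t_p^{q+1}$ be the smallest $t\ge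 t_p^q$ such that $$\min_{\emptyset\ne S\subsetneq\mathcal N}\ \sum_{i\in S}\sum_{j\notin S}\int_{t_p^q}^{t}a_{ij}(s)\,ds=1,$$ and let $t_{p+1}=t_p^{\lfloor n/2\rfloor}$. Then all these times exist, and for every $t\ge 0$ there is exactly one $p\in\mathbb N$ with $t\in[t_p,t_{p+1})$; denote it by $P(t)$. For every trajectory $x$ and every $t\ge 0$, $$\Delta(t)\le\Bigl(1-\frac{1}{(8Kn^2)^{\lfloor n/2\rfloor}}\Bigr)^{P(t)}\Delta(0),$$ and, in particular, every trajectory reaches a consensus: there is $c\in\mathbb R$ with $\lim_{t\to\infty}x_i(t)=c$ for all $i\in\mathcal N$. -/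

import Mathlib

open MeasureTheory Filter Topology Set

noncomputable section

namespace Consensus

/-- Interaction weights of `n` agents: `a i j t` is the strength, at time `t ≥ 0`, of the influence
of agent `j` on agent `i`. They are non-negative, measurable, and integrable on bounded intervals
of `[0, ∞)` (`IntegrableOn` includes Lebesgue measurability). Values at negative times are
irrelevant. -/
structure IsWeights {n : ℕ} (a : Fin n → Fin n → ℝ → ℝ) : Prop where
  nonneg : ∀ i j : Fin n, ∀ t : ℝ, 0 ≤ t → 0 ≤ a i j t
  integrableOn : ∀ i j : Fin n, ∀ T : ℝ, IntegrableOn (a i j) (Icc 0 T)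

/-- A trajectory: a locally absolutely continuous Carathéodory solution on `[0, ∞)` of
`x_i' = ∑ j, a_ij (x_j - x_i)`. -/
structure IsTrajectory {n : ℕ} (a : Fin n → Fin n → ℝ → ℝ) (x : Fin n → ℝ → ℝ) : Prop where
  absolutelyContinuous : ∀ i : Fin n, ∀ T : ℝ, 0 ≤ T → AbsolutelyContinuousOnInterval (x i) 0 T
  integral_eq : ∀ i : Fin n, ∀ t : ℝ, 0 ≤ t →
    x i t = x i 0 + ∫ s in (0 : ℝ)..t, ∑ j : Fin n, a i j s * (x j s - x i s)

/-- The group diameter `max_i x_i(t) - min_j x_j(t)`. -/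
def diameter {n : ℕ} (x : Fin n → ℝ → ℝ) (t : ℝ) : ℝ :=
  (⨆ i : Fin n, x i t) - ⨅ j : Fin n, x j t

/-- All positions converge to one common value. -/
def ReachesConsensus {n : ℕ} (x : Fin n → ℝ → ℝ) : Prop :=
  ∃ c : ℝ, ∀ i : Fin n, Tendsto (x i) atTop (𝓝 c)

/-- `(j, i)` is an edge of the unbounded interaction graph: `∫_0^∞ a_ij = +∞`. -/
def UnboundedEdge {n : ℕ} (a : Fin n → Fin n → ℝ → ℝ) (j i : Fin n) : Prop :=
  ∫⁻ s in Ici (0 : ℝ), ENNReal.ofReal (a i j s) = ⊤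

/-- Persistent connectivity: the unbounded interaction graph is strongly connected, i.e. there is
a directed path from `k` to `l` for all distinct nodes `k`, `l`. -/
def PersistentConnectivity {n : ℕ} (a : Fin n → Fin n → ℝ → ℝ) : Prop :=
  ∀ k l : Fin n, k ≠ l → Relation.TransGen (UnboundedEdge a) k l

/-- Cut-balanced weights with constant `K`. -/
def CutBalanced {n : ℕ} (a : Fin n → Fin n → ℝ → ℝ) (K : ℝ) : Prop :=
  ∀ S : Finset (Fin n), S.Nonempty → S ≠ Finset.univ → ∀ t : ℝ, 0 ≤ t →
    K⁻¹ * ∑ i ∈ S, ∑ j ∈ Sᶜ, a j i t ≤ ∑ i ∈ S, ∑ j ∈ Sᶜ, a i j t ∧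
    ∑ i ∈ S, ∑ j ∈ Sᶜ, a i j t ≤ K * ∑ i ∈ S, ∑ j ∈ Sᶜ, a j i t

/-- The minimum over non-empty proper subsets `S` of the influence
`∑_{i ∈ S} ∑_{j ∉ S} ∫_s^t a_ij` accumulated over `[s, t]`. -/
def minInfluence {n : ℕ} (a : Fin n → Fin n → ℝ → ℝ) (s t : ℝ) : ℝ :=
  ⨅ S : {S : Finset (Fin n) // S.Nonempty ∧ S ≠ Finset.univ},
    ∑ i ∈ S.1, ∑ j ∈ S.1ᶜ, ∫ u in s..t, a i j u

/-- The times `t ≥ s` at which the minimal influence accumulated since `s` equals `1`. -/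
def unitTimes {n : ℕ} (a : Fin n → Fin n → ℝ → ℝ) (s : ℝ) : Set ℝ :=
  {t : ℝ | s ≤ t ∧ minInfluence a s t = 1}

/-- The smallest element of `unitTimes a s`. -/
def nextTime {n : ℕ} (a : Fin n → Fin n → ℝ → ℝ) (s : ℝ) : ℝ :=
  sInf (unitTimes a s)

/-- The times `t_p`: `t_0 = 0`, and `t_{p+1}` is obtained from `t_p` by `⌊n / 2⌋` successive
applications of `nextTime`. -/
def rescaledTime {n : ℕ} (a : Fin n → Fin n → ℝ → ℝ) : ℕ → ℝ
  | 0 => 0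
  | p + 1 => (nextTime a)^[n / 2] (rescaledTime a p)

/-- The intermediate times `t_p^q`, with `t_p^0 = t_p` and `t_p^⌊n/2⌋ = t_{p+1}`. -/
def intermediateTime {n : ℕ} (a : Fin n → Fin n → ℝ → ℝ) (p q : ℕ) : ℝ :=
  (nextTime a)^[q] (rescaledTime a p)

end Consensus

end

noncomputable section

namespace Consensus

/-! ### Finite minima of absolutely continuous functions -/

/-! The maximum of the positions never increases and the minimum never decreases, so it suffices to
contract the diameter `D` over one period of `⌊n/2⌋` intervals, in each of which every cut receives
influence at least 1. Call an agent low if it lies below the midpoint. Replacing `x` by `-x` if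
necessary, at most `n/2` agents are low. Shift the minimum to 0, so that the others start above `η =
D/2`. Each interval forces at least one agent out of a non-empty low group, and after `⌊n/2⌋`
intervals the group is empty: the minimum has risen.

To see that an agent leaves, stop when the low group has received influence exactly `1/(2K)`. By cut
balance its complement has received at most `1/2`, so it is still above `η/2`. If a low agent
exceeds `η/4` on the way, it has left. Otherwise a gap of at least `η/4` persists, and the sum of
the sorted low positions with geometric weights `K^(l-c)` grows at least at the rate gap times
influence (`gap_mul_cutSum_le`): at each rank the ratio `K` of consecutive weights absorbs the
possible imbalance of the cut. So some low position has been raised, together with all positions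
above it (`IsTrajectory.exists_raised`, `IsTrajectory.exists_smaller_group`).

All differential inequalities come from `lower_bound_of_active`, applied to finite minima: of
positions, of positions capped by a constant, and of weighted sums over all permutations, where by
rearrangement the sorted order attains the minimum. Thus crossings of agents never have to be
tracked. -/

theorem absolutelyContinuous_min {f g : ℝ → ℝ} {s T : ℝ}
    (hf : AbsolutelyContinuousOnInterval f s T) (hg : AbsolutelyContinuousOnInterval g s T) :
    AbsolutelyContinuousOnInterval (fun t => min (f t) (g t)) s T := by
  refine squeeze_zero (fun E => Finset.sum_nonneg fun i _ => dist_nonneg) (fun E => ?_)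
    (by simpa using Tendsto.add hf hg)
  rw [← Finset.sum_add_distrib]
  refine Finset.sum_le_sum fun i _ => ?_
  simp only [Real.dist_eq]
  exact (abs_min_sub_min_le_max _ _ _ _).trans
    (max_le_add_of_nonneg (abs_nonneg _) (abs_nonneg _))

theorem absolutelyContinuous_inf' {ι : Type*} {A : Finset ι} (hA : A.Nonempty) {f : ι → ℝ → ℝ}
    {s T : ℝ} (hf : ∀ i ∈ A, AbsolutelyContinuousOnInterval (f i) s T) :
    AbsolutelyContinuousOnInterval (fun t => A.inf' hA fun i => f i t) s T := by
  classical
  induction hA using Finset.Nonempty.cons_induction with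
  | singleton i => simpa using hf i
  | cons i A hi hA ih =>
    simp only [Finset.inf'_cons hA]
    exact absolutelyContinuous_min (hf i (by simp)) (ih fun j hj => hf j (by simp [hj]))

theorem absolutelyContinuous_const (c s T : ℝ) :
    AbsolutelyContinuousOnInterval (fun _ : ℝ => c) s T :=
  contDiffOn_const.absolutelyContinuousOnInterval

theorem absolutelyContinuous_sum {ι : Type*} (A : Finset ι) {f : ι → ℝ → ℝ} {s T : ℝ}
    (hf : ∀ i ∈ A, AbsolutelyContinuousOnInterval (f i) s T) :
    AbsolutelyContinuousOnInterval (fun t => ∑ i ∈ A, f i t) s T := by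
  classical
  induction A using Finset.induction_on with
  | empty => simpa using absolutelyContinuous_const 0 s T
  | insert i A hi ih =>
    simp only [Finset.sum_insert hi]
    exact (hf i (by simp)).fun_add (ih fun j hj => hf j (by simp [hj]))

/-- If almost everywhere some minimal member of a finite family has derivative at least `r`, the
minimum of the family grows at least by the integral of `r`. -/
theorem lower_bound_of_active {ι : Type*} {A : Finset ι} {f d : ι → ℝ → ℝ} {r : ℝ → ℝ} {s T c : ℝ}
    (hsT : s ≤ T) (hf : ∀ i ∈ A, AbsolutelyContinuousOnInterval (f i) s T)
    (hd : ∀ i ∈ A, ∀ᵐ t, t ∈ Ioo s T → HasDerivAt (f i) (d i t) t)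
    (hr : IntervalIntegrable r volume s T)
    (hact : ∀ t ∈ Ioo s T, ∃ i ∈ A, (∀ j ∈ A, f i t ≤ f j t) ∧ r t ≤ d i t)
    (hc : ∀ i ∈ A, c ≤ f i s) {i : ι} (hi : i ∈ A) :
    c + (∫ t in s..T, r t) ≤ f i T := by
  have hA : A.Nonempty := ⟨i, hi⟩
  set m : ℝ → ℝ := fun t => A.inf' hA fun i => f i t with hm
  have hmac : AbsolutelyContinuousOnInterval m s T := absolutelyContinuous_inf' hA hf
  have hd' : ∀ᵐ t, ∀ i ∈ A, t ∈ Ioo s T → HasDerivAt (f i) (d i t) t :=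
    (ae_ball_iff A.countable_toSet).2 hd
  have hle : (∫ t in s..T, r t) ≤ ∫ t in s..T, deriv m t := by
    refine intervalIntegral.integral_mono_ae_restrict hsT hr hmac.intervalIntegrable_deriv ?_
    have hs : ∀ᵐ t : ℝ, t ≠ s := by simp [ae_iff, measure_singleton]
    have hT : ∀ᵐ t : ℝ, t ≠ T := by simp [ae_iff, measure_singleton]
    change ∀ᵐ t ∂volume.restrict (Icc s T), r t ≤ deriv m t
    rw [ae_restrict_iff' measurableSet_Icc]
    filter_upwards [hs, hT, hd', hmac.ae_differentiableAt] with t hts htT hdt hmt ht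
    have ht' : t ∈ Ioo s T := ⟨lt_of_le_of_ne ht.1 (Ne.symm hts), lt_of_le_of_ne ht.2 htT⟩
    obtain ⟨k, hk, hmin, hrk⟩ := hact t ht'
    have hmd := (hmt (by rwa [uIcc_of_le hsT])).hasDerivAt
    have hkd := hdt k hk ht'
    have hmk : m t = f k t :=
      le_antisymm (Finset.inf'_le _ hk) (Finset.le_inf' _ _ hmin)
    -- `m` lies below `f k` and touches it at `t`, so their derivatives agree there. The active
    -- index needs no measurable choice.
    have hmax : IsLocalMax (fun u => m u - f k u) t := by
      refine Eventually.of_forall fun u => ?_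
      have : m u ≤ f k u := Finset.inf'_le _ hk
      show m u - f k u ≤ m t - f k t
      linarith
    have h0 := hmax.hasDerivAt_eq_zero (hmd.sub hkd)
    linarith
  rw [hmac.integral_deriv_eq_sub] at hle
  have h1 : c ≤ m s := Finset.le_inf' _ _ hc
  have h2 : m T ≤ f i T := Finset.inf'_le _ hi
  linarith

/-! ### Weighted sums of ordered positions under cut balance -/

/-- The total influence `∑_{i ∈ S} ∑_{j ∉ S} b i j` exerted on `S` by its complement. -/
def cutSum {n : ℕ} (b : Fin n → Fin n → ℝ) (S : Finset (Fin n)) : ℝ :=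
  ∑ i ∈ S, ∑ j ∈ Sᶜ, b i j

/-- Geometric weights `K ^ (l - c)` for ranks `c ≤ l`, and zero beyond rank `l`. -/
def rankWeight (K : ℝ) (l c : ℕ) : ℝ := if c ≤ l then K ^ (l - c) else 0

theorem rankWeight_nonneg {K : ℝ} (hK : 1 ≤ K) (l c : ℕ) : 0 ≤ rankWeight K l c := by
  unfold rankWeight; split_ifs <;> positivity

/-- This decay compensates the factor `K` lost when the influence on a complement is bounded by that
on the set. -/
theorem mul_rankWeight_succ_le {K : ℝ} (hK : 1 ≤ K) (l c : ℕ) :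
    K * rankWeight K l (c + 1) ≤ rankWeight K l c := by
  unfold rankWeight
  by_cases h : c + 1 ≤ l
  · rw [if_pos h, if_pos (by omega), show l - c = l - (c + 1) + 1 by omega, pow_succ, mul_comm]
  · rw [if_neg h, mul_zero]; split_ifs <;> positivity

theorem rankWeight_antitone {K : ℝ} (hK : 1 ≤ K) (l : ℕ) : Antitone (rankWeight K l) :=
  antitone_nat_of_succ_le fun c =>
    (le_mul_of_one_le_left (rankWeight_nonneg hK l _) hK).trans (mul_rankWeight_succ_le hK l c)

theorem cutSum_nonneg {n : ℕ} {b : Fin n → Fin n → ℝ} (hb : ∀ i j, 0 ≤ b i j)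
    (S : Finset (Fin n)) : 0 ≤ cutSum b S :=
  Finset.sum_nonneg fun i _ => Finset.sum_nonneg fun j _ => hb i j

theorem cutSum_eq_sum_ite {n : ℕ} (b : Fin n → Fin n → ℝ) (p : Fin n → Prop) [DecidablePred p] :
    cutSum b (Finset.univ.filter p) = ∑ i, ∑ j, if p i ∧ ¬ p j then b i j else 0 := by
  unfold cutSum
  rw [Finset.sum_filter, Finset.compl_filter]
  refine Finset.sum_congr rfl fun i _ => ?_
  by_cases h : p i <;> simp [h, Finset.sum_filter]

theorem cutSum_compl_eq {n : ℕ} (b : Fin n → Fin n → ℝ) (S : Finset (Fin n)) :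
    cutSum b Sᶜ = ∑ i ∈ S, ∑ j ∈ Sᶜ, b j i := by
  unfold cutSum
  rw [compl_compl, Finset.sum_comm]

theorem sub_eq_sum_range_ite {Y : ℕ → ℝ} {N k m : ℕ} (hk : k ≤ N) (hm : m ≤ N) :
    Y m - Y k = ∑ c ∈ Finset.range N,
      (Y (c + 1) - Y c) * ((if c < m then 1 else 0) - if c < k then 1 else 0) := by
  have key : ∀ m ≤ N, Y m - Y 0 = ∑ c ∈ Finset.range N,
      (Y (c + 1) - Y c) * (if c < m then 1 else 0) := by
    intro m hm
    rw [← Finset.sum_range_sub]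
    simp only [mul_ite, mul_one, mul_zero]
    rw [← Finset.sum_filter]
    refine Finset.sum_congr ?_ fun _ _ => rfl
    ext c
    simp only [Finset.mem_range, Finset.mem_filter]
    omega
  simp only [mul_sub, Finset.sum_sub_distrib]
  rw [← key m hm, ← key k hk]
  ring

/-- Pairs on the same side of level `c` cancel. An agent at or below the level weighs at least `w
c`; one above it weighs at most `w (c + 1)`. -/
theorem weighted_level_bound {n : ℕ} {b : Fin n → Fin n → ℝ} (hb : ∀ i j, 0 ≤ b i j)
    {w : ℕ → ℝ} (hw : Antitone w) (ρ : Fin n → ℕ) (c : ℕ) :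
    w c * cutSum b (Finset.univ.filter fun i => ρ i ≤ c) -
        w (c + 1) * cutSum b (Finset.univ.filter fun i => ρ i ≤ c)ᶜ ≤
      ∑ i, ∑ j, w (ρ i) * b i j * ((if c < ρ j then 1 else 0) - if c < ρ i then 1 else 0) := by
  rw [Finset.compl_filter, cutSum_eq_sum_ite, cutSum_eq_sum_ite]
  simp only [Finset.mul_sum]
  simp only [← Finset.sum_sub_distrib]
  refine Finset.sum_le_sum fun i _ => Finset.sum_le_sum fun j _ => ?_
  have hbij := hb i j
  by_cases hi : ρ i ≤ c <;> by_cases hj : ρ j ≤ c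
  · simp [hi, hj, not_lt.2 hi, not_lt.2 hj]
  · have := mul_le_mul_of_nonneg_right (hw hi) hbij
    simpa [hi, hj, not_le.1 hj, not_lt.2 hi] using this
  · have := mul_le_mul_of_nonneg_right (hw (Nat.succ_le_of_lt (not_le.1 hi))) hbij
    simpa [hi, hj, not_le.1 hi, not_lt.2 hj] using this
  · simp [hi, hj, not_le.1 hj, not_le.1 hi]

/-- Ordered positions with geometrically decreasing weights: cut balance forces the weighted sum
to grow at least at the rate at which the lowest `l + 1` positions are attracted by the others. -/
theorem gap_mul_cutSum_le {n : ℕ} {b : Fin n → Fin n → ℝ} (hb : ∀ i j, 0 ≤ b i j)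
    {K : ℝ} (hK : 1 ≤ K) (hcut : ∀ S, cutSum b Sᶜ ≤ K * cutSum b S)
    {Y : ℕ → ℝ} (hY : Monotone Y) {ρ : Fin n → ℕ} {N l : ℕ} (hρ : ∀ i, ρ i ≤ N) (hl : l < N) :
    (Y (l + 1) - Y l) * cutSum b (Finset.univ.filter fun i => ρ i ≤ l) ≤
      ∑ i, rankWeight K l (ρ i) * ∑ j, b i j * (Y (ρ j) - Y (ρ i)) := by
  have hexp : (∑ i, rankWeight K l (ρ i) * ∑ j, b i j * (Y (ρ j) - Y (ρ i))) =
      ∑ c ∈ Finset.range N, (Y (c + 1) - Y c) * ∑ i, ∑ j, rankWeight K l (ρ i) * b i j *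
        ((if c < ρ j then 1 else 0) - if c < ρ i then 1 else 0) := by
    simp only [Finset.mul_sum]
    conv_rhs => rw [Finset.sum_comm]
    refine Finset.sum_congr rfl fun i _ => ?_
    conv_rhs => rw [Finset.sum_comm]
    refine Finset.sum_congr rfl fun j _ => ?_
    rw [sub_eq_sum_range_ite (hρ i) (hρ j), Finset.mul_sum, Finset.mul_sum]
    exact Finset.sum_congr rfl fun c _ => by ring
  rw [hexp]
  have hlev := weighted_level_bound hb (rankWeight_antitone hK l) ρ
  have hgap : ∀ c, 0 ≤ Y (c + 1) - Y c := fun c => sub_nonneg.2 (hY (Nat.le_succ c))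
  -- After expanding differences into consecutive gaps, every level contributes a non-negative
  -- amount. Only level `l` is kept: there the weights drop from 1 to 0, so nothing is subtracted.
  refine le_trans ?_ (Finset.single_le_sum (f := fun c => (Y (c + 1) - Y c) * ∑ i, ∑ j,
    rankWeight K l (ρ i) * b i j * ((if c < ρ j then 1 else 0) - if c < ρ i then 1 else 0))
    (fun c _ => mul_nonneg (hgap c) ?_)
    (Finset.mem_range.2 hl))
  · refine mul_le_mul_of_nonneg_left ((le_of_eq ?_).trans (hlev l)) (hgap l)
    simp [rankWeight]
  · refine le_trans ?_ (hlev c)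
    have h1 := mul_le_mul_of_nonneg_left (hcut (Finset.univ.filter fun i => ρ i ≤ c))
      (rankWeight_nonneg hK l (c + 1))
    have h2 := mul_le_mul_of_nonneg_right (mul_rankWeight_succ_le hK l c)
      (cutSum_nonneg hb (Finset.univ.filter fun i => ρ i ≤ c))
    linarith

/-! ### Integrability of weights and regularity of trajectories -/

theorem intervalIntegrable_sum {ι : Type*} (A : Finset ι) {f : ι → ℝ → ℝ} {s t : ℝ}
    (hf : ∀ i ∈ A, IntervalIntegrable (f i) volume s t) :
    IntervalIntegrable (fun u => ∑ i ∈ A, f i u) volume s t := by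
  have h := IntervalIntegrable.sum A hf
  rwa [show (∑ i ∈ A, f i) = fun u => ∑ i ∈ A, f i u by ext u; simp] at h

theorem IsWeights.intervalIntegrable {n : ℕ} {a : Fin n → Fin n → ℝ → ℝ} (ha : IsWeights a)
    (i j : Fin n) {s t : ℝ} (hs : 0 ≤ s) (ht : 0 ≤ t) :
    IntervalIntegrable (a i j) volume s t := by
  have h : ∀ T, 0 ≤ T → IntervalIntegrable (a i j) volume 0 T := fun T hT =>
    (intervalIntegrable_iff_integrableOn_Icc_of_le hT).2 (ha.integrableOn i j T)
  exact (h s hs).symm.trans (h t ht)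

theorem IsWeights.cutSum_nonneg {n : ℕ} {a : Fin n → Fin n → ℝ → ℝ} (ha : IsWeights a)
    (S : Finset (Fin n)) {t : ℝ} (ht : 0 ≤ t) : 0 ≤ cutSum (fun i j => a i j t) S :=
  Consensus.cutSum_nonneg (fun i j => ha.nonneg i j t ht) S

theorem IsWeights.intervalIntegrable_cutSum {n : ℕ} {a : Fin n → Fin n → ℝ → ℝ}
    (ha : IsWeights a) (S : Finset (Fin n)) {s t : ℝ} (hs : 0 ≤ s) (ht : 0 ≤ t) :
    IntervalIntegrable (fun u => cutSum (fun i j => a i j u) S) volume s t := by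
  exact intervalIntegrable_sum S fun i _ => intervalIntegrable_sum Sᶜ fun j _ =>
    ha.intervalIntegrable i j hs ht

/-- The influence `∫_s^t ∑_{i ∈ S} ∑_{j ∉ S} a i j` accumulated by `S` over `[s, t]`. -/
def influence {n : ℕ} (a : Fin n → Fin n → ℝ → ℝ) (S : Finset (Fin n)) (s t : ℝ) : ℝ :=
  ∫ u in s..t, cutSum (fun i j => a i j u) S

theorem influence_eq_sum {n : ℕ} {a : Fin n → Fin n → ℝ → ℝ} (ha : IsWeights a)
    (S : Finset (Fin n)) {s t : ℝ} (hs : 0 ≤ s) (ht : 0 ≤ t) :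
    influence a S s t = ∑ i ∈ S, ∑ j ∈ Sᶜ, ∫ u in s..t, a i j u := by
  unfold influence cutSum
  rw [intervalIntegral.integral_finsetSum]
  · refine Finset.sum_congr rfl fun i _ => ?_
    rw [intervalIntegral.integral_finsetSum]
    exact fun j _ => ha.intervalIntegrable i j hs ht
  · intro i _
    exact intervalIntegrable_sum Sᶜ fun j _ => ha.intervalIntegrable i j hs ht

theorem influence_add {n : ℕ} {a : Fin n → Fin n → ℝ → ℝ} (ha : IsWeights a)
    (S : Finset (Fin n)) {s t u : ℝ} (hs : 0 ≤ s) (ht : 0 ≤ t) (hu : 0 ≤ u) :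
    influence a S s t + influence a S t u = influence a S s u :=
  intervalIntegral.integral_add_adjacent_intervals (ha.intervalIntegrable_cutSum S hs ht)
    (ha.intervalIntegrable_cutSum S ht hu)

theorem influence_nonneg {n : ℕ} {a : Fin n → Fin n → ℝ → ℝ} (ha : IsWeights a)
    (S : Finset (Fin n)) {s t : ℝ} (hs : 0 ≤ s) (hst : s ≤ t) : 0 ≤ influence a S s t :=
  intervalIntegral.integral_nonneg hst fun _ hu => ha.cutSum_nonneg S (hs.trans hu.1)

theorem influence_mono {n : ℕ} {a : Fin n → Fin n → ℝ → ℝ} (ha : IsWeights a)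
    (S : Finset (Fin n)) {s t u : ℝ} (hs : 0 ≤ s) (hst : s ≤ t) (htu : t ≤ u) :
    influence a S s t ≤ influence a S s u := by
  rw [← influence_add ha S hs (hs.trans hst) ((hs.trans hst).trans htu)]
  exact le_add_of_nonneg_right (influence_nonneg ha S (hs.trans hst) htu)

theorem continuousOn_influence {n : ℕ} {a : Fin n → Fin n → ℝ → ℝ} (ha : IsWeights a)
    (S : Finset (Fin n)) {s T : ℝ} (hs : 0 ≤ s) (hsT : s ≤ T) :
    ContinuousOn (influence a S s) (Icc s T) := by
  have h := intervalIntegral.continuousOn_primitive_interval'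
    (ha.intervalIntegrable_cutSum S hs (hs.trans hsT)) left_mem_uIcc
  rwa [uIcc_of_le hsT] at h

theorem CutBalanced.cutSum_compl_le {n : ℕ} {a : Fin n → Fin n → ℝ → ℝ} {K : ℝ}
    (hcut : CutBalanced a K) (hK : 1 ≤ K) {t : ℝ} (ht : 0 ≤ t) (S : Finset (Fin n)) :
    cutSum (fun i j => a i j t) Sᶜ ≤ K * cutSum (fun i j => a i j t) S := by
  rcases S.eq_empty_or_nonempty with rfl | hS
  · simp [cutSum]
  by_cases hS' : S = Finset.univ
  · subst hS'
    simp [cutSum]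
  rw [cutSum_compl_eq]
  have h := (hcut S hS hS' t ht).1
  rwa [inv_mul_le_iff₀ (by linarith)] at h

theorem influence_compl_le {n : ℕ} {a : Fin n → Fin n → ℝ → ℝ} (ha : IsWeights a) {K : ℝ}
    (hcut : CutBalanced a K) (hK : 1 ≤ K) (S : Finset (Fin n)) {s t : ℝ} (hs : 0 ≤ s)
    (hst : s ≤ t) : influence a Sᶜ s t ≤ K * influence a S s t := by
  unfold influence
  rw [← intervalIntegral.integral_const_mul]
  exact intervalIntegral.integral_mono_on hst
    (ha.intervalIntegrable_cutSum _ hs (hs.trans hst))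
    ((ha.intervalIntegrable_cutSum _ hs (hs.trans hst)).const_mul K)
    fun u hu => hcut.cutSum_compl_le hK (hs.trans hu.1) S

/-- The right-hand side of the consensus dynamics. -/
def velocity {n : ℕ} (a : Fin n → Fin n → ℝ → ℝ) (x : Fin n → ℝ → ℝ) (i : Fin n) (t : ℝ) : ℝ :=
  ∑ j, a i j t * (x j t - x i t)

theorem IsTrajectory.absolutelyContinuous_Icc {n : ℕ} {a : Fin n → Fin n → ℝ → ℝ}
    {x : Fin n → ℝ → ℝ} (hx : IsTrajectory a x) (i : Fin n) {s T : ℝ} (hs : 0 ≤ s)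
    (hsT : s ≤ T) : AbsolutelyContinuousOnInterval (x i) s T := by
  refine (hx.absolutelyContinuous i T (hs.trans hsT)).mono ?_
  rw [uIcc_of_le hsT, uIcc_of_le (hs.trans hsT)]
  exact Icc_subset_Icc_left hs

theorem IsTrajectory.intervalIntegrable_velocity {n : ℕ} {a : Fin n → Fin n → ℝ → ℝ}
    (ha : IsWeights a) {x : Fin n → ℝ → ℝ} (hx : IsTrajectory a x) (i : Fin n) {T : ℝ}
    (hT : 0 ≤ T) : IntervalIntegrable (velocity a x i) volume 0 T := by
  exact intervalIntegrable_sum Finset.univ fun j _ =>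
    (ha.intervalIntegrable i j le_rfl hT).mul_continuousOn
      ((hx.absolutelyContinuous j T hT).continuousOn.sub
        (hx.absolutelyContinuous i T hT).continuousOn)

theorem IsTrajectory.ae_hasDerivAt {n : ℕ} {a : Fin n → Fin n → ℝ → ℝ} (ha : IsWeights a)
    {x : Fin n → ℝ → ℝ} (hx : IsTrajectory a x) (i : Fin n) {s T : ℝ} (hs : 0 ≤ s) (hsT : s ≤ T) :
    ∀ᵐ t, t ∈ Ioo s T → HasDerivAt (x i) (velocity a x i t) t := by
  have hT := hs.trans hsT
  filter_upwards [(hx.intervalIntegrable_velocity ha i hT).ae_hasDerivAt_integral] with t ht hts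
  have ht0 : 0 < t := hs.trans_lt hts.1
  have h := ht (by rw [uIcc_of_le hT]; exact ⟨ht0.le, hts.2.le⟩) 0 left_mem_uIcc
  refine (h.const_add (x i 0)).congr_of_eventuallyEq ?_
  -- The integral equation holds only at non-negative times, hence in a neighbourhood of `t > 0`.
  filter_upwards [lt_mem_nhds ht0] with u hu
  exact hx.integral_eq i u hu.le

/-! ### Monotonicity of the minimum and slow decay of a group -/

/-- Lower bounds on the positions persist. -/
theorem IsTrajectory.lower_bound {n : ℕ} {a : Fin n → Fin n → ℝ → ℝ} (ha : IsWeights a)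
    {x : Fin n → ℝ → ℝ} (hx : IsTrajectory a x) {s T c : ℝ} (hs : 0 ≤ s) (hsT : s ≤ T)
    (hc : ∀ i, c ≤ x i s) (i : Fin n) : c ≤ x i T := by
  have h := lower_bound_of_active (A := Finset.univ) (f := x) (d := velocity a x)
    (r := fun _ => 0) (c := c) hsT (fun i _ => hx.absolutelyContinuous_Icc i hs hsT)
    (fun i _ => hx.ae_hasDerivAt ha i hs hsT) intervalIntegrable_const ?_ (fun i _ => hc i)
    (Finset.mem_univ i)
  · simpa using h
  · intro t ht
    obtain ⟨k, -, hk⟩ := Finset.exists_min_image Finset.univ (fun i => x i t) ⟨i, by simp⟩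
    refine ⟨k, by simp, hk, Finset.sum_nonneg fun j _ => ?_⟩
    exact mul_nonneg (ha.nonneg _ _ _ (hs.trans ht.1.le)) (sub_nonneg.2 (hk j (by simp)))

/-- A group above level `η` is pulled down at most by `η` times the influence it undergoes. -/
theorem IsTrajectory.group_lower_bound {n : ℕ} {a : Fin n → Fin n → ℝ → ℝ} (ha : IsWeights a)
    {x : Fin n → ℝ → ℝ} (hx : IsTrajectory a x) {s T η : ℝ} (hs : 0 ≤ s) (hsT : s ≤ T)
    (hη : 0 ≤ η) (h0 : ∀ i, 0 ≤ x i s) {H : Finset (Fin n)} (hH : ∀ i ∈ H, η ≤ x i s)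
    {i : Fin n} (hi : i ∈ H) : η - η * influence a H s T ≤ x i T := by
  -- The index `none` carries the constant `η`. An active agent is then at height at most `η`, so
  -- each outside agent, being non-negative, pulls it down by at most `η` per unit of weight.
  have h := lower_bound_of_active (A := Finset.insertNone H)
    (f := fun o t => o.elim η fun i => x i t) (d := fun o t => o.elim 0 fun i => velocity a x i t)
    (r := fun t => -η * cutSum (fun i j => a i j t) H) (c := η) hsT ?_ ?_
    ((ha.intervalIntegrable_cutSum H hs (hs.trans hsT)).const_mul (-η)) ?_ ?_
    (Finset.some_mem_insertNone.2 hi)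
  · rw [intervalIntegral.integral_const_mul] at h
    have h' : η + -η * influence a H s T ≤ x i T := h
    linarith
  · rintro (_ | j) -
    · exact absolutelyContinuous_const η s T
    · exact hx.absolutelyContinuous_Icc j hs hsT
  · rintro (_ | j) -
    · exact Eventually.of_forall fun t _ => hasDerivAt_const t η
    · exact hx.ae_hasDerivAt ha j hs hsT
  · intro t ht
    have ht0 : 0 ≤ t := hs.trans ht.1.le
    obtain ⟨o, ho, hmin⟩ := Finset.exists_min_image (Finset.insertNone H)
      (fun o => o.elim η fun i => x i t) ⟨none, by simp⟩
    refine ⟨o, ho, hmin, ?_⟩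
    rcases o with _ | k
    · have := mul_nonneg hη (ha.cutSum_nonneg H ht0)
      simp only [Option.elim_none]
      linarith
    · have hk : k ∈ H := Finset.some_mem_insertNone.1 ho
      have hkη : x k t ≤ η := hmin none (by simp)
      have hkj : ∀ j ∈ H, x k t ≤ x j t := fun j hj =>
        hmin (some j) (Finset.some_mem_insertNone.2 hj)
      have hpos : ∀ j, 0 ≤ x j t := hx.lower_bound ha hs ht.1.le h0
      have h1 : ∑ j ∈ Hᶜ, a k j t ≤ cutSum (fun i j => a i j t) H :=
        Finset.single_le_sum (f := fun i => ∑ j ∈ Hᶜ, a i j t)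
          (fun i _ => Finset.sum_nonneg fun j _ => ha.nonneg i j t ht0) hk
      have h2 : -η * ∑ j ∈ Hᶜ, a k j t ≤ velocity a x k t := by
        unfold velocity
        rw [← Finset.sum_add_sum_compl H, Finset.mul_sum]
        have h3 : 0 ≤ ∑ j ∈ H, a k j t * (x j t - x k t) := Finset.sum_nonneg fun j hj =>
          mul_nonneg (ha.nonneg _ _ _ ht0) (sub_nonneg.2 (hkj j hj))
        have h4 : ∑ j ∈ Hᶜ, -η * a k j t ≤ ∑ j ∈ Hᶜ, a k j t * (x j t - x k t) :=
          Finset.sum_le_sum fun j _ => by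
            have := mul_le_mul_of_nonneg_left (show -η ≤ x j t - x k t by linarith [hpos j])
              (ha.nonneg k j t ht0)
            linarith
        linarith
      have h5 := mul_le_mul_of_nonneg_left h1 hη
      simp only [Option.elim_some]
      linarith
  · rintro (_ | j) hj
    · exact le_rfl
    · exact hH j (Finset.some_mem_insertNone.1 hj)

/-! ### Growth of the ordered positions -/

/-- Any finite family of reals can be ranked. -/
theorem exists_ranking {n : ℕ} (hn : 0 < n) (z : Fin n → ℝ) :
    ∃ σ : Equiv.Perm (Fin n), ∃ Y : ℕ → ℝ, Monotone Y ∧ ∀ i, z i = Y (σ i) := by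
  -- Ranks beyond `n - 1` repeat the top value, which keeps `Y` monotone on all of `ℕ`.
  refine ⟨(Tuple.sort z).symm, fun c => z (Tuple.sort z ⟨min c (n - 1), by omega⟩), ?_, ?_⟩
  · intro c d hcd
    refine Tuple.monotone_sort z ?_
    simp only [Fin.mk_le_mk]
    omega
  · intro i
    have h : (⟨min ((Tuple.sort z).symm i : ℕ) (n - 1), by omega⟩ : Fin n) =
        (Tuple.sort z).symm i := by
      ext
      have := ((Tuple.sort z).symm i).2
      simp only
      omega
    simp only [h, Equiv.apply_symm_apply]

/-- Among all assignments of decreasing weights, the ranking minimizes the weighted sum. -/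
theorem ranking_sum_le {n : ℕ} {w : ℕ → ℝ} (hw : Antitone w) {z : Fin n → ℝ}
    {σ : Equiv.Perm (Fin n)} {Y : ℕ → ℝ} (hY : Monotone Y) (hz : ∀ i, z i = Y (σ i))
    (τ : Equiv.Perm (Fin n)) : ∑ i, w (σ i) * z i ≤ ∑ i, w (τ i) * z i := by
  have h : Antivary (fun i => w (σ i)) z := by
    intro i j hij
    rw [hz i, hz j] at hij
    exact hw (le_of_not_ge fun h => absurd (hY h) (not_le.2 hij))
  simpa using h.sum_mul_le_sum_comp_perm_mul (σ := τ.trans σ.symm)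

theorem card_rank_lt {n : ℕ} (σ : Equiv.Perm (Fin n)) {k : ℕ} (hk : k ≤ n) :
    (Finset.univ.filter fun i => (σ i : ℕ) < k).card = k := by
  have h : (Finset.univ.filter fun i => (σ i : ℕ) < k) =
      (Finset.univ.filter fun c : Fin n => (c : ℕ) < k).map σ.symm.toEmbedding := by
    ext i
    simp [Finset.mem_map_equiv]
  rw [h, Finset.card_map, Fin.card_filter_val_lt, min_eq_right hk]

/-- A group separated from the others by a gap consists of the lowest ranks. -/
theorem rank_le_eq_of_gap {n l : ℕ} {z : Fin n → ℝ} {σ : Equiv.Perm (Fin n)} {Y : ℕ → ℝ}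
    (hY : Monotone Y) (hz : ∀ i, z i = Y (σ i)) {L : Finset (Fin n)} (hL : L.card = l + 1)
    {α β : ℝ} (hαβ : α < β) (hα : ∀ i ∈ L, z i ≤ α) (hβ : ∀ i ∉ L, β ≤ z i) :
    (Finset.univ.filter fun i => (σ i : ℕ) ≤ l) = L := by
  have hln : l + 1 ≤ n := by simpa [hL] using L.card_le_univ
  have hcard := card_rank_lt σ hln
  simp only [Nat.lt_succ_iff] at hcard
  refine Finset.eq_of_subset_of_card_le ?_ (by rw [hL, hcard])
  intro j hj
  by_contra hjL
  obtain ⟨i, hiL, hi⟩ : ∃ i ∈ L, i ∉ Finset.univ.filter fun i => (σ i : ℕ) ≤ l := by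
    by_contra! hsub
    have h := Finset.eq_of_subset_of_card_le hsub (by rw [hL, hcard])
    exact hjL (h ▸ hj)
  simp only [Finset.mem_filter, Finset.mem_univ, true_and, not_le] at hi hj
  have h1 := hα i hiL
  have h2 := hβ j hjL
  rw [hz] at h1 h2
  have h3 : Y (σ j) ≤ Y (σ i) := hY (hj.trans hi.le)
  linarith

/-- If a group of `l + 1` agents stays below level `α` while the others stay above `β`, then the
influence on the group raises all but at most `k ≤ l` agents by a controlled amount. -/
theorem IsTrajectory.exists_raised {n : ℕ} {a : Fin n → Fin n → ℝ → ℝ} (ha : IsWeights a)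
    {K : ℝ} (hK : 1 ≤ K) (hcut : CutBalanced a K) {x : Fin n → ℝ → ℝ} (hx : IsTrajectory a x)
    {s T α β : ℝ} (hs : 0 ≤ s) (hsT : s ≤ T) (h0 : ∀ i, 0 ≤ x i s) {L : Finset (Fin n)} {l : ℕ}
    (hL : L.card = l + 1) (hln : l + 1 < n) (hαβ : α < β)
    (hα : ∀ t ∈ Icc s T, ∀ i ∈ L, x i t ≤ α) (hβ : ∀ t ∈ Icc s T, ∀ i ∉ L, β ≤ x i t) :
    ∃ k ≤ l, ∃ L' : Finset (Fin n), L'.card = k ∧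
      ∀ i ∉ L', (β - α) * influence a L s T ≤ (l + 1) * (K ^ (l - k) * x i T) := by
  have hn : 0 < n := by omega
  have hgrow : ∀ τ : Equiv.Perm (Fin n),
      (β - α) * influence a L s T ≤ ∑ i, rankWeight K l (τ i) * x i T := by
    intro τ
    -- The sorted weighted sum is the minimum over all permutations, so the active permutation is a
    -- ranking at time `t`.
    have h := lower_bound_of_active (A := (Finset.univ : Finset (Equiv.Perm (Fin n))))
      (f := fun σ t => ∑ i, rankWeight K l (σ i) * x i t)
      (d := fun σ t => ∑ i, rankWeight K l (σ i) * velocity a x i t)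
      (r := fun t => (β - α) * cutSum (fun i j => a i j t) L) (c := 0) hsT ?_ ?_
      ((ha.intervalIntegrable_cutSum L hs (hs.trans hsT)).const_mul _) ?_ ?_
      (Finset.mem_univ τ)
    · rw [intervalIntegral.integral_const_mul, zero_add] at h
      exact h
    · exact fun σ _ => absolutelyContinuous_sum _ fun i _ =>
        (hx.absolutelyContinuous_Icc i hs hsT).const_mul _
    · intro σ _
      have hall : ∀ᵐ t, ∀ i, t ∈ Ioo s T → HasDerivAt (x i) (velocity a x i t) t :=
        ae_all_iff.2 fun i => hx.ae_hasDerivAt ha i hs hsT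
      filter_upwards [hall] with t ht hts
      exact HasDerivAt.fun_sum fun i _ => (ht i hts).const_mul _
    · intro t ht
      have ht0 : 0 ≤ t := hs.trans ht.1.le
      have htI : t ∈ Icc s T := Ioo_subset_Icc_self ht
      obtain ⟨σ, Y, hY, hz⟩ := exists_ranking hn fun i => x i t
      refine ⟨σ, Finset.mem_univ _,
        fun τ _ => ranking_sum_le (rankWeight_antitone hK l) hY hz τ, ?_⟩
      have hLeq := rank_le_eq_of_gap hY hz hL hαβ (hα t htI) (hβ t htI)
      have hkey := gap_mul_cutSum_le (fun i j => ha.nonneg i j t ht0) hK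
        (hcut.cutSum_compl_le hK ht0) hY (ρ := fun i => (σ i : ℕ)) (fun i => (σ i).2.le)
        (show l < n by omega)
      rw [hLeq] at hkey
      have hgap : β - α ≤ Y (l + 1) - Y l := by
        have hmem : ∀ c : Fin n, σ.symm c ∈ L ↔ (c : ℕ) ≤ l := by
          intro c
          rw [← hLeq]
          simp
        have h1 := hα t htI _ ((hmem ⟨l, by omega⟩).2 le_rfl)
        have h2 := hβ t htI (σ.symm ⟨l + 1, hln⟩) (by rw [hmem]; simp)
        have e1 := hz (σ.symm ⟨l, by omega⟩)
        have e2 := hz (σ.symm ⟨l + 1, hln⟩)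
        simp only [Equiv.apply_symm_apply] at e1 e2
        linarith
      refine (mul_le_mul_of_nonneg_right hgap (ha.cutSum_nonneg L ht0)).trans (hkey.trans ?_)
      refine le_of_eq (Finset.sum_congr rfl fun i _ => ?_)
      simp only [velocity, hz]
    · exact fun σ _ => Finset.sum_nonneg fun i _ => mul_nonneg (rankWeight_nonneg hK _ _) (h0 i)
  obtain ⟨σ, Y, hY, hz⟩ := exists_ranking hn fun i => x i T
  have hsum : ∑ i, rankWeight K l (σ i) * x i T =
      ∑ i ∈ Finset.univ.filter (fun i => (σ i : ℕ) < l + 1), K ^ (l - (σ i : ℕ)) * x i T := by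
    rw [Finset.sum_filter]
    refine Finset.sum_congr rfl fun i _ => ?_
    simp only [rankWeight, Nat.lt_succ_iff]
    split_ifs <;> simp
  have hcard := card_rank_lt σ hln.le
  -- One of the `l + 1` terms reaches the average. Its rank is the `k` sought, and all higher ranks
  -- lie at least as high.
  have hex : ∃ i ∈ Finset.univ.filter (fun i => (σ i : ℕ) < l + 1),
      (β - α) * influence a L s T / (l + 1) ≤ K ^ (l - (σ i : ℕ)) * x i T := by
    refine Finset.exists_le_of_sum_le (Finset.card_pos.1 (by omega)) ?_
    rw [← hsum, Finset.sum_const, hcard, nsmul_eq_mul]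
    push_cast
    rw [mul_div_cancel₀ _ (by positivity)]
    exact hgrow σ
  obtain ⟨i, hi, hle⟩ := hex
  have hil : (σ i : ℕ) ≤ l := by simpa [Nat.lt_succ_iff] using hi
  refine ⟨σ i, hil, Finset.univ.filter fun j => (σ j : ℕ) < σ i, card_rank_lt σ (σ i).2.le, ?_⟩
  intro j hj
  have hij : (σ i : ℕ) ≤ σ j := by simpa using hj
  have hxx : x i T ≤ x j T := by
    have e1 := hz i
    have e2 := hz j
    rw [e1, e2]
    exact hY hij
  rw [div_le_iff₀ (by positivity)] at hle
  have := mul_le_mul_of_nonneg_left hxx (show 0 ≤ (l + 1 : ℝ) * K ^ (l - (σ i : ℕ)) by positivity)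
  linarith

/-! ### Contraction of the diameter -/

/-- By cut balance the complement of `L` undergoes influence at most `1/2`, hence loses at most half
its height. -/
theorem IsTrajectory.group_lower_bound_of_influence_le {n : ℕ} {a : Fin n → Fin n → ℝ → ℝ}
    (ha : IsWeights a) {K : ℝ} (hK : 1 ≤ K) (hcut : CutBalanced a K) {x : Fin n → ℝ → ℝ}
    (hx : IsTrajectory a x) {s T η : ℝ} (hs : 0 ≤ s) (hsT : s ≤ T) (hη : 0 ≤ η)
    (h0 : ∀ i, 0 ≤ x i s) {L : Finset (Fin n)} (hL : ∀ i ∉ L, η ≤ x i s)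
    (hinf : influence a L s T ≤ 1 / (2 * K)) {i : Fin n} (hi : i ∉ L) : η / 2 ≤ x i T := by
  have h := hx.group_lower_bound ha hs hsT hη h0 (H := Lᶜ)
    (fun i hi => hL i (Finset.mem_compl.1 hi)) (Finset.mem_compl.2 hi)
  have h1 := influence_compl_le ha hcut hK L hs hsT
  have h2 : K * influence a L s T ≤ 1 / 2 := by
    have := mul_le_mul_of_nonneg_left hinf (show 0 ≤ K by linarith)
    refine this.trans (le_of_eq ?_)
    field_simp
  have h3 := mul_le_mul_of_nonneg_left (h1.trans h2) hη
  linarith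

theorem exists_influence_eq {n : ℕ} {a : Fin n → Fin n → ℝ → ℝ} (ha : IsWeights a)
    (S : Finset (Fin n)) {s T c : ℝ} (hs : 0 ≤ s) (hsT : s ≤ T) (hc : 0 ≤ c)
    (h : c ≤ influence a S s T) : ∃ t ∈ Icc s T, influence a S s t = c :=
  intermediate_value_Icc hsT (continuousOn_influence ha S hs hsT)
    ⟨by simpa [influence] using hc, h⟩

/-- When a low group of at most `n / 2` agents has undergone enough influence, some of its members
have left it, each at the cost of a factor `4 n K`. -/
theorem IsTrajectory.exists_smaller_group {n : ℕ} {a : Fin n → Fin n → ℝ → ℝ}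
    (ha : IsWeights a) {K : ℝ} (hK : 1 ≤ K) (hcut : CutBalanced a K) {x : Fin n → ℝ → ℝ}
    (hx : IsTrajectory a x) {s T η : ℝ} (hs : 0 ≤ s) (hsT : s ≤ T) (hη : 0 < η)
    (h0 : ∀ i, 0 ≤ x i s) {L : Finset (Fin n)} {l : ℕ} (hcard : L.card = l + 1)
    (hln : 2 * (l + 1) ≤ n) (hL : ∀ i ∉ L, η ≤ x i s) (hinf : 1 / (2 * K) ≤ influence a L s T) :
    ∃ t ∈ Icc s T, ∃ k ≤ l, ∃ L' : Finset (Fin n), L'.card = k ∧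
      ∀ i ∉ L', η / (4 * n * K) ^ (l + 1 - k) ≤ x i t := by
  obtain ⟨u, hu, hinfu⟩ := exists_influence_eq ha L hs hsT (by positivity) hinf
  have hβ : ∀ t ∈ Icc s u, ∀ i ∉ L, η / 2 ≤ x i t := fun t ht i hi =>
    hx.group_lower_bound_of_influence_le ha hK hcut hs ht.1 hη.le h0 hL
      ((influence_mono ha L hs ht.1 ht.2).trans hinfu.le) hi
  have hlR : 2 * ((l : ℝ) + 1) ≤ n := by exact_mod_cast hln
  have hn1 : (1 : ℝ) ≤ n := by have : (0 : ℝ) ≤ l := Nat.cast_nonneg l; linarith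
  by_cases hα : ∀ t ∈ Icc s u, ∀ i ∈ L, x i t ≤ η / 4
  · obtain ⟨k, hk, L', hL', hle⟩ := hx.exists_raised ha hK hcut hs hu.1 h0 hcard (by omega)
      (by linarith) hα hβ
    refine ⟨u, hu, k, hk, L', hL', fun i hi => ?_⟩
    have h1 := hle i hi
    have hxi : 0 ≤ x i u := hx.lower_bound ha hs hu.1 h0 i
    have hKl : 0 < K ^ (l - k) := by positivity
    have h2 : η ≤ 8 * (l + 1) * K * K ^ (l - k) * x i u := by
      rw [hinfu, mul_one_div, div_le_iff₀ (by positivity)] at h1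
      linarith
    -- The 8 combines the gap `η/2 - η/4` with the influence `1/(2K)`; `2(l + 1) ≤ n` turns `8(l +
    -- 1)` into `4n`.
    have h3 : 8 * (l + 1) * K * K ^ (l - k) ≤ (4 * n * K) ^ (l + 1 - k) := by
      rw [show l + 1 - k = (l - k) + 1 by omega, pow_succ, mul_pow (4 * (n : ℝ)) K]
      have h4 : (1 : ℝ) ≤ (4 * n) ^ (l - k) := one_le_pow₀ (by linarith)
      have h5 : 8 * ((l : ℝ) + 1) * K ≤ 4 * n * K :=
        mul_le_mul_of_nonneg_right (by linarith) (by linarith)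
      calc 8 * (l + 1) * K * K ^ (l - k) ≤ 4 * n * K * K ^ (l - k) :=
            mul_le_mul_of_nonneg_right h5 hKl.le
        _ = 1 * K ^ (l - k) * (4 * n * K) := by ring
        _ ≤ (4 * n) ^ (l - k) * K ^ (l - k) * (4 * n * K) := by gcongr
    rw [div_le_iff₀ (by positivity)]
    have := mul_le_mul_of_nonneg_right h3 hxi
    linarith
  · push Not at hα
    obtain ⟨t, ht, i, hi, hxi⟩ := hα
    refine ⟨t, ⟨ht.1, ht.2.trans hu.2⟩, l, le_rfl, L.erase i, ?_, fun j hj => ?_⟩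
    · rw [Finset.card_erase_of_mem hi, hcard, Nat.add_sub_cancel]
    · have h4 : η / (4 * n * K) ^ (l + 1 - l) ≤ η / 4 := by
        rw [Nat.add_sub_cancel_left, pow_one]
        gcongr
        nlinarith
      refine h4.trans ?_
      by_cases hji : j = i
      · exact hji ▸ hxi.le
      · have := hβ t ht j fun hjL => hj (Finset.mem_erase.2 ⟨hji, hjL⟩)
        linarith

/-- Either too little influence remains before `T` and the complement at most halves, or agents
leave earlier and the argument restarts with a smaller group. The factor 2 is paid only in the last
stage, while the exponents of `4nK` add up to the number of departures. -/
theorem IsTrajectory.exists_group {n : ℕ} {a : Fin n → Fin n → ℝ → ℝ}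
    (ha : IsWeights a) {K : ℝ} (hK : 1 ≤ K) (hcut : CutBalanced a K) {x : Fin n → ℝ → ℝ}
    (hx : IsTrajectory a x) {T : ℝ} (l : ℕ) : ∀ {s η : ℝ}, 0 ≤ s → s ≤ T → 0 < η →
    (∀ i, 0 ≤ x i s) → ∀ {L : Finset (Fin n)}, L.card = l → 2 * l ≤ n → (∀ i ∉ L, η ≤ x i s) →
    ∃ k ≤ l, ∃ L' : Finset (Fin n), L'.card = k ∧
      ∀ i ∉ L', η / (2 * (4 * n * K) ^ (l - k)) ≤ x i T := by
  induction l using Nat.strong_induction_on with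
  | _ l ih =>
    intro s η hs hsT hη h0 L hcard hln hL
    rcases le_total (influence a L s T) (1 / (2 * K)) with hinf | hinf
    · refine ⟨l, le_rfl, L, hcard, fun i hi => ?_⟩
      simpa using hx.group_lower_bound_of_influence_le ha hK hcut hs hsT hη.le h0 hL hinf hi
    · rcases l with _ | l
      · refine ⟨0, le_rfl, L, hcard, fun i hi => ?_⟩
        have hL0 : L = ∅ := Finset.card_eq_zero.1 hcard
        have := hx.lower_bound ha hs hsT (fun j => hL j (by simp [hL0])) i
        simp only [Nat.sub_self, pow_zero, mul_one]
        linarith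
      · obtain ⟨t, ht, k, hk, L', hL', hle⟩ :=
          hx.exists_smaller_group ha hK hcut hs hsT hη h0 hcard hln hL hinf
        have hC : 0 < 4 * (n : ℝ) * K := by
          have : (0 : ℝ) < n := by exact_mod_cast (show 0 < n by omega)
          positivity
        obtain ⟨k', hk', L'', hL'', hle'⟩ := ih k (by omega) (hs.trans ht.1) ht.2
          (div_pos hη (pow_pos hC _)) (hx.lower_bound ha hs ht.1 h0) hL' (by omega) hle
        refine ⟨k', by omega, L'', hL'', fun i hi => le_trans (le_of_eq ?_) (hle' i hi)⟩
        rw [div_div, show l + 1 - k' = (l + 1 - k) + (k - k') by omega, pow_add]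
        congr 1
        ring

/-- Influence 1 exceeds the threshold `1/(2K)`, so a departure is certain before `exists_group`
takes over. For an empty group, `l - 1` truncates to 0. -/
theorem IsTrajectory.exists_group_lt {n : ℕ} {a : Fin n → Fin n → ℝ → ℝ}
    (ha : IsWeights a) {K : ℝ} (hK : 1 ≤ K) (hcut : CutBalanced a K) {x : Fin n → ℝ → ℝ}
    (hx : IsTrajectory a x) {s T η : ℝ} (hs : 0 ≤ s) (hsT : s ≤ T) (hη : 0 < η)
    (h0 : ∀ i, 0 ≤ x i s) {L : Finset (Fin n)} {l : ℕ} (hcard : L.card = l)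
    (hln : 2 * l ≤ n) (hL : ∀ i ∉ L, η ≤ x i s)
    (hinf : ∀ S : Finset (Fin n), S.Nonempty → S ≠ Finset.univ → 1 ≤ influence a S s T) :
    ∃ k ≤ l - 1, ∃ L' : Finset (Fin n), L'.card = k ∧
      ∀ i ∉ L', η / (2 * (4 * n * K) ^ (l - k)) ≤ x i T := by
  rcases l with _ | l
  · exact hx.exists_group ha hK hcut 0 hs hsT hη h0 hcard hln hL
  have hLne : L.Nonempty := Finset.card_pos.1 (by omega)
  have hLu : L ≠ Finset.univ := by
    rintro rfl
    simp only [Finset.card_univ, Fintype.card_fin] at hcard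
    omega
  have hinfL : 1 / (2 * K) ≤ influence a L s T :=
    le_trans (by rw [div_le_one (by positivity)]; linarith) (hinf L hLne hLu)
  obtain ⟨t, ht, k, hk, L', hL', hle⟩ :=
    hx.exists_smaller_group ha hK hcut hs hsT hη h0 hcard hln hL hinfL
  have hC : 0 < 4 * (n : ℝ) * K := by
    have : (0 : ℝ) < n := by exact_mod_cast (show 0 < n by omega)
    positivity
  obtain ⟨k', hk', L'', hL'', hle'⟩ := hx.exists_group ha hK hcut k (hs.trans ht.1) ht.2
    (div_pos hη (pow_pos hC _)) (hx.lower_bound ha hs ht.1 h0) hL' (by omega) hle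
  refine ⟨k', by omega, L'', hL'', fun i hi => le_trans (le_of_eq ?_) (hle' i hi)⟩
  rw [div_div, show l + 1 - k' = (l + 1 - k) + (k - k') by omega, pow_add]
  congr 1
  ring

/-- Each interval costs a factor 2 and each departure a factor `4nK`, in whichever interval it
occurs, since the exponents telescope. -/
theorem IsTrajectory.exists_group_iterate {n : ℕ} {a : Fin n → Fin n → ℝ → ℝ}
    (ha : IsWeights a) {K : ℝ} (hK : 1 ≤ K) (hcut : CutBalanced a K) {x : Fin n → ℝ → ℝ}
    (hx : IsTrajectory a x) {τ : ℕ → ℝ} {m : ℕ} (hτ0 : 0 ≤ τ 0) (hτ : Monotone τ)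
    (hinf : ∀ q < m, ∀ S : Finset (Fin n), S.Nonempty → S ≠ Finset.univ →
      1 ≤ influence a S (τ q) (τ (q + 1)))
    {η : ℝ} (hη : 0 < η) (h0 : ∀ i, 0 ≤ x i (τ 0)) {L : Finset (Fin n)} {l : ℕ}
    (hcard : L.card = l) (hln : 2 * l ≤ n) (hn : 0 < n) (hL : ∀ i ∉ L, η ≤ x i (τ 0)) :
    ∀ q ≤ m, ∃ k ≤ l - q, ∃ L' : Finset (Fin n), L'.card = k ∧
      ∀ i ∉ L', η / (2 ^ q * (4 * n * K) ^ (l - k)) ≤ x i (τ q) := by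
  have hC : 0 < 4 * (n : ℝ) * K := by
    have : (0 : ℝ) < n := by exact_mod_cast hn
    positivity
  intro q
  induction q with
  | zero => exact fun _ => ⟨l, le_rfl, L, hcard, by simpa using hL⟩
  | succ q ih =>
    intro hq
    obtain ⟨k, hk, L', hL', hle⟩ := ih (by omega)
    have hq0 : 0 ≤ τ q := hτ0.trans (hτ (Nat.zero_le q))
    obtain ⟨k', hk', L'', hL'', hle'⟩ := hx.exists_group_lt ha hK hcut hq0 (hτ (Nat.le_succ q))
      (div_pos hη (mul_pos (by positivity) (pow_pos hC _)))
      (hx.lower_bound ha hτ0 (hτ (Nat.zero_le q)) h0) hL' (by omega) hle (hinf q (by omega))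
    refine ⟨k', by omega, L'', hL'', fun i hi => le_trans (le_of_eq ?_) (hle' i hi)⟩
    rw [div_div, show l - k' = (l - k) + (k - k') by omega, pow_add, pow_succ]
    congr 1
    ring

theorem IsTrajectory.sub_const {n : ℕ} {a : Fin n → Fin n → ℝ → ℝ} {x : Fin n → ℝ → ℝ}
    (hx : IsTrajectory a x) (c : ℝ) : IsTrajectory a fun i t => x i t - c where
  absolutelyContinuous i T hT :=
    (hx.absolutelyContinuous i T hT).fun_sub (absolutelyContinuous_const c 0 T)
  integral_eq i t ht := by
    rw [hx.integral_eq i t ht]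
    simp only [sub_sub_sub_cancel_right]
    ring

theorem IsTrajectory.neg {n : ℕ} {a : Fin n → Fin n → ℝ → ℝ} {x : Fin n → ℝ → ℝ}
    (hx : IsTrajectory a x) : IsTrajectory a fun i t => -x i t where
  absolutelyContinuous i T hT := (hx.absolutelyContinuous i T hT).fun_neg
  integral_eq i t ht := by
    rw [hx.integral_eq i t ht, neg_add, ← intervalIntegral.integral_neg]
    congr 2
    ext u
    rw [← Finset.sum_neg_distrib]
    exact Finset.sum_congr rfl fun j _ => by ring

theorem IsTrajectory.raise_of_card_le {n : ℕ} (hn : 2 ≤ n) {a : Fin n → Fin n → ℝ → ℝ}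
    (ha : IsWeights a) {K : ℝ} (hK : 1 ≤ K) (hcut : CutBalanced a K) {x : Fin n → ℝ → ℝ}
    (hx : IsTrajectory a x) {τ : ℕ → ℝ} (hτ0 : 0 ≤ τ 0) (hτ : Monotone τ)
    (hinf : ∀ q < n / 2, ∀ S : Finset (Fin n), S.Nonempty → S ≠ Finset.univ →
      1 ≤ influence a S (τ q) (τ (q + 1)))
    {c D : ℝ} (hD : 0 < D) (hc : ∀ i, c ≤ x i (τ 0))
    (hcard : 2 * (Finset.univ.filter fun i => x i (τ 0) < c + D / 2).card ≤ n) (i : Fin n) :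
    c + D / (8 * K * (n : ℝ) ^ 2) ^ (n / 2) ≤ x i (τ (n / 2)) := by
  set L := Finset.univ.filter fun i => x i (τ 0) < c + D / 2 with hLdef
  obtain ⟨k, hk, L', hL', hle⟩ := (hx.sub_const c).exists_group_iterate ha hK hcut hτ0 hτ hinf
    (half_pos hD) (fun i => sub_nonneg.2 (hc i)) (L := L) rfl hcard (by omega)
    (fun i hi => by
      have : c + D / 2 ≤ x i (τ 0) := by simpa [hLdef] using hi
      linarith) (n / 2) le_rfl
  obtain rfl : k = 0 := by omega
  have h := hle i (by simp [Finset.card_eq_zero.1 hL'])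
  have hnR : (2 : ℝ) ≤ n := by exact_mod_cast hn
  rw [Nat.sub_zero, div_div] at h
  have hC : 1 ≤ 4 * (n : ℝ) * K := by nlinarith
  -- The leading 2 comes from starting at the midpoint; it is absorbed by `n ^ (n / 2)`, as `n / 2 ≥
  -- 1`.
  have hbound : 2 * (2 ^ (n / 2) * (4 * n * K) ^ L.card) ≤ (8 * K * (n : ℝ) ^ 2) ^ (n / 2) := by
    calc 2 * (2 ^ (n / 2) * (4 * n * K) ^ L.card)
        ≤ (n : ℝ) ^ (n / 2) * (2 ^ (n / 2) * (4 * n * K) ^ (n / 2)) := by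
          gcongr
          · exact hnR.trans (le_self_pow₀ (by linarith) (by omega))
          · omega
      _ = (8 * K * (n : ℝ) ^ 2) ^ (n / 2) := by
          rw [← mul_pow, ← mul_pow]
          congr 1
          ring
  have h2 := div_le_div_of_nonneg_left hD.le (by positivity) hbound
  linarith

theorem iInf_le_pos {n : ℕ} (x : Fin n → ℝ → ℝ) (t : ℝ) (i : Fin n) : ⨅ j, x j t ≤ x i t :=
  ciInf_le (Set.finite_range _).bddBelow i

theorem pos_le_iSup {n : ℕ} (x : Fin n → ℝ → ℝ) (t : ℝ) (i : Fin n) : x i t ≤ ⨆ j, x j t :=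
  le_ciSup (f := fun j => x j t) (Set.finite_range _).bddAbove i

theorem diameter_le {n : ℕ} (hn : 0 < n) {x : Fin n → ℝ → ℝ} {t m M : ℝ}
    (hm : ∀ i, m ≤ x i t) (hM : ∀ i, x i t ≤ M) : diameter x t ≤ M - m := by
  have : Nonempty (Fin n) := ⟨⟨0, hn⟩⟩
  exact sub_le_sub (ciSup_le hM) (le_ciInf hm)

theorem diameter_nonneg {n : ℕ} (hn : 0 < n) (x : Fin n → ℝ → ℝ) (t : ℝ) : 0 ≤ diameter x t :=
  sub_nonneg.2 ((iInf_le_pos x t ⟨0, hn⟩).trans (pos_le_iSup x t ⟨0, hn⟩))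

theorem IsTrajectory.upper_bound {n : ℕ} {a : Fin n → Fin n → ℝ → ℝ} (ha : IsWeights a)
    {x : Fin n → ℝ → ℝ} (hx : IsTrajectory a x) {s T c : ℝ} (hs : 0 ≤ s) (hsT : s ≤ T)
    (hc : ∀ i, x i s ≤ c) (i : Fin n) : x i T ≤ c :=
  neg_le_neg_iff.1 (hx.neg.lower_bound ha hs hsT (fun i => neg_le_neg (hc i)) i)

theorem IsTrajectory.diameter_antitone {n : ℕ} (hn : 0 < n) {a : Fin n → Fin n → ℝ → ℝ}
    (ha : IsWeights a) {x : Fin n → ℝ → ℝ} (hx : IsTrajectory a x) {s T : ℝ} (hs : 0 ≤ s)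
    (hsT : s ≤ T) : diameter x T ≤ diameter x s :=
  diameter_le hn (hx.lower_bound ha hs hsT (iInf_le_pos x s))
    (hx.upper_bound ha hs hsT (pos_le_iSup x s))

/-- Over `⌊n / 2⌋` successive intervals of minimal influence at least one, the diameter contracts. -/
theorem IsTrajectory.diameter_contraction {n : ℕ} (hn : 2 ≤ n) {a : Fin n → Fin n → ℝ → ℝ}
    (ha : IsWeights a) {K : ℝ} (hK : 1 ≤ K) (hcut : CutBalanced a K) {x : Fin n → ℝ → ℝ}
    (hx : IsTrajectory a x) {τ : ℕ → ℝ} (hτ0 : 0 ≤ τ 0) (hτ : Monotone τ)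
    (hinf : ∀ q < n / 2, ∀ S : Finset (Fin n), S.Nonempty → S ≠ Finset.univ →
      1 ≤ influence a S (τ q) (τ (q + 1))) :
    diameter x (τ (n / 2)) ≤
      (1 - 1 / (8 * K * (n : ℝ) ^ 2) ^ (n / 2)) * diameter x (τ 0) := by
  have hn0 : 0 < n := by omega
  have hle0 := hτ (Nat.zero_le (n / 2))
  -- The group argument needs a positive height, so zero diameter is treated apart.
  rcases (diameter_nonneg hn0 x (τ 0)).eq_or_lt with hD | hD
  · have := hx.diameter_antitone hn0 ha hτ0 hle0
    rw [← hD] at this ⊢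
    simpa using this
  set D := diameter x (τ 0) with hDdef
  set m := ⨅ j, x j (τ 0) with hm
  set M := ⨆ j, x j (τ 0) with hM
  have hMm : M - m = D := rfl
  have hlow : ∀ i, m ≤ x i (τ 0) := iInf_le_pos x (τ 0)
  have hup : ∀ i, x i (τ 0) ≤ M := pos_le_iSup x (τ 0)
  have hlowT := hx.lower_bound ha hτ0 hle0 hlow
  have hupT := hx.upper_bound ha hτ0 hle0 hup
  set A := Finset.univ.filter fun i => x i (τ 0) < m + D / 2
  -- Since `-M` is the minimum of `-x`, this is the set strictly above the midpoint. It is disjoint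
  -- from `A`, so one of the two has at most `n/2` members.
  set B := Finset.univ.filter fun i => -x i (τ 0) < -M + D / 2
  have hAB : A.card + B.card ≤ n := by
    rw [← Finset.card_union_of_disjoint]
    · simpa using (A ∪ B).card_le_univ
    · refine Finset.disjoint_filter.2 fun i _ h1 h2 => ?_
      linarith
  rcases le_total A.card B.card with h | h
  · have hr := hx.raise_of_card_le hn ha hK hcut hτ0 hτ hinf hD hlow
      (show 2 * A.card ≤ n by omega)
    refine (diameter_le hn0 hr hupT).trans (le_of_eq ?_)
    rw [← hMm]
    ring
  · have hr := hx.neg.raise_of_card_le hn ha hK hcut hτ0 hτ hinf hD (fun i => neg_le_neg (hup i))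
      (show 2 * B.card ≤ n by omega)
    refine (diameter_le hn0 hlowT fun i => le_neg_of_le_neg (hr i)).trans (le_of_eq ?_)
    rw [← hMm]
    ring

/-! ### The rescaled times -/

theorem nonempty_properSubset {n : ℕ} (hn : 2 ≤ n) :
    Nonempty {S : Finset (Fin n) // S.Nonempty ∧ S ≠ Finset.univ} := by
  refine ⟨⟨{⟨0, by omega⟩}, by simp, fun h => ?_⟩⟩
  have := congrArg Finset.card h
  simp only [Finset.card_singleton, Finset.card_univ, Fintype.card_fin] at this
  omega

theorem minInfluence_eq {n : ℕ} {a : Fin n → Fin n → ℝ → ℝ} (ha : IsWeights a) {s t : ℝ}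
    (hs : 0 ≤ s) (ht : 0 ≤ t) : minInfluence a s t =
      ⨅ S : {S : Finset (Fin n) // S.Nonempty ∧ S ≠ Finset.univ}, influence a S.1 s t := by
  unfold minInfluence
  exact iInf_congr fun S => (influence_eq_sum ha S.1 hs ht).symm

theorem minInfluence_self {n : ℕ} (a : Fin n → Fin n → ℝ → ℝ) (s : ℝ) :
    minInfluence a s s = 0 := by
  simp [minInfluence]

theorem minInfluence_le {n : ℕ} {a : Fin n → Fin n → ℝ → ℝ} (ha : IsWeights a) {s t : ℝ}
    (hs : 0 ≤ s) (ht : 0 ≤ t) {S : Finset (Fin n)} (hS : S.Nonempty) (hS' : S ≠ Finset.univ) :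
    minInfluence a s t ≤ influence a S s t := by
  rw [minInfluence_eq ha hs ht]
  exact ciInf_le (f := fun S : {S : Finset (Fin n) // S.Nonempty ∧ S ≠ Finset.univ} =>
    influence a S.1 s t) (Set.finite_range _).bddBelow ⟨S, hS, hS'⟩

theorem continuousOn_minInfluence {n : ℕ} (hn : 2 ≤ n) {a : Fin n → Fin n → ℝ → ℝ}
    (ha : IsWeights a) {s T : ℝ} (hs : 0 ≤ s) (hsT : s ≤ T) :
    ContinuousOn (minInfluence a s) (Icc s T) := by
  have := nonempty_properSubset hn
  refine (ContinuousOn.finset_inf'_apply Finset.univ_nonempty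
    (f := fun S : {S : Finset (Fin n) // S.Nonempty ∧ S ≠ Finset.univ} => influence a S.1 s)
    fun S _ => continuousOn_influence ha S.1 hs hsT).congr fun t ht => ?_
  rw [minInfluence_eq ha hs (hs.trans ht.1)]
  exact (Finset.inf'_univ_eq_ciInf _).symm

/-- A path that ends inside a set and starts outside must enter it; this yields an unbounded edge
into every cut. -/
theorem exists_edge_of_transGen {α : Type*} {r : α → α → Prop} {k l : α}
    (h : Relation.TransGen r k l) {p : α → Prop} (hk : ¬ p k) (hl : p l) :
    ∃ j i, ¬ p j ∧ p i ∧ r j i := by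
  induction h with
  | single h => exact ⟨_, _, hk, hl, h⟩
  | @tail b c _ hbc ih =>
    by_cases hb : p b
    · exact ih hb
    · exact ⟨b, c, hb, hl, hbc⟩

theorem exists_one_le_integral {n : ℕ} {a : Fin n → Fin n → ℝ → ℝ} (ha : IsWeights a)
    {i j : Fin n} (h : UnboundedEdge a j i) {s : ℝ} (hs : 0 ≤ s) :
    ∃ T, s ≤ T ∧ 1 ≤ ∫ u in s..T, a i j u := by
  by_contra! hlt
  -- Bounded partial integrals make a non-negative function integrable on the half-line, against the
  -- infinite integral.
  have hIoi : IntegrableOn (a i j) (Ioi s) := by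
    refine integrableOn_Ioi_of_intervalIntegral_norm_bounded 1 s (b := id) (l := atTop)
      (fun t => ((ha.integrableOn i j t).mono_set ?_)) tendsto_id ?_
    · exact fun u hu => ⟨hs.trans hu.1.le, hu.2⟩
    · filter_upwards [eventually_ge_atTop s] with t ht
      refine le_trans (le_of_eq (intervalIntegral.integral_congr fun u hu => ?_)) (hlt t ht).le
      rw [id, uIcc_of_le ht] at hu
      exact Real.norm_of_nonneg (ha.nonneg i j u (hs.trans hu.1))
  have hIci : IntegrableOn (a i j) (Ici 0) := by
    rw [← Icc_union_Ioi_eq_Ici hs]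
    exact (ha.integrableOn i j s).union hIoi
  exact absurd h hIci.lintegral_lt_top.ne

theorem exists_one_le_influence {n : ℕ} {a : Fin n → Fin n → ℝ → ℝ} (ha : IsWeights a)
    (hconn : PersistentConnectivity a) {S : Finset (Fin n)} (hS : S.Nonempty)
    (hS' : S ≠ Finset.univ) {s : ℝ} (hs : 0 ≤ s) : ∃ T, s ≤ T ∧ 1 ≤ influence a S s T := by
  obtain ⟨l, hl⟩ := hS
  obtain ⟨k, hk⟩ : ∃ k, k ∉ S := by
    by_contra! h
    exact hS' (Finset.eq_univ_iff_forall.2 h)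
  obtain ⟨j, i, hj, hi, hij⟩ := exists_edge_of_transGen (p := (· ∈ S))
    (hconn k l fun h => hk (h ▸ hl)) hk hl
  obtain ⟨T, hsT, hT⟩ := exists_one_le_integral ha hij hs
  refine ⟨T, hsT, hT.trans ?_⟩
  rw [influence_eq_sum ha S hs (hs.trans hsT)]
  have hnn : ∀ i j, 0 ≤ ∫ u in s..T, a i j u := fun i j =>
    intervalIntegral.integral_nonneg hsT fun u hu => ha.nonneg i j u (hs.trans hu.1)
  exact (Finset.single_le_sum (f := fun j => ∫ u in s..T, a i j u) (fun j _ => hnn i j)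
    (Finset.mem_compl.2 hj)).trans
    (Finset.single_le_sum (f := fun i => ∑ j ∈ Sᶜ, ∫ u in s..T, a i j u)
      (fun i _ => Finset.sum_nonneg fun j _ => hnn i j) hi)

theorem exists_one_le_minInfluence {n : ℕ} (hn : 2 ≤ n) {a : Fin n → Fin n → ℝ → ℝ}
    (ha : IsWeights a) (hconn : PersistentConnectivity a) {s : ℝ} (hs : 0 ≤ s) :
    ∃ T, s ≤ T ∧ 1 ≤ minInfluence a s T := by
  have := nonempty_properSubset hn
  choose τ hτ h1 using fun S : {S : Finset (Fin n) // S.Nonempty ∧ S ≠ Finset.univ} =>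
    exists_one_le_influence ha hconn S.2.1 S.2.2 hs
  obtain ⟨T, hT⟩ := (Set.finite_range τ).bddAbove
  have hle : ∀ S, τ S ≤ T := fun S => hT (mem_range_self S)
  have hsT : s ≤ T := (hτ (Classical.arbitrary _)).trans (hle _)
  refine ⟨T, hsT, ?_⟩
  rw [minInfluence_eq ha hs (hs.trans hsT)]
  exact le_ciInf fun S => (h1 S).trans (influence_mono ha S.1 hs (hτ S) (hle S))

theorem isLeast_nextTime {n : ℕ} (hn : 2 ≤ n) {a : Fin n → Fin n → ℝ → ℝ}
    (ha : IsWeights a) (hconn : PersistentConnectivity a) {s : ℝ} (hs : 0 ≤ s) :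
    IsLeast (unitTimes a s) (nextTime a s) := by
  obtain ⟨T, hsT, hT⟩ := exists_one_le_minInfluence hn ha hconn hs
  have hcont := continuousOn_minInfluence hn ha hs hsT
  -- Compactness gives a least solution in `[s, T]`; solutions beyond `T` are larger anyway.
  have hcomp : IsCompact (Icc s T ∩ minInfluence a s ⁻¹' {1}) :=
    isCompact_Icc.of_isClosed_subset
      (hcont.preimage_isClosed_of_isClosed isClosed_Icc isClosed_singleton) inter_subset_left
  obtain ⟨u, hu, hu1⟩ := intermediate_value_Icc hsT hcont
    ⟨by rw [minInfluence_self]; exact zero_le_one, hT⟩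
  obtain ⟨v, hv, hvmin⟩ := hcomp.exists_isLeast ⟨u, hu, hu1⟩
  have hleast : IsLeast (unitTimes a s) v := by
    refine ⟨⟨hv.1.1, hv.2⟩, fun t ht => ?_⟩
    rcases le_total t T with htT | htT
    · exact hvmin ⟨⟨ht.1, htT⟩, ht.2⟩
    · exact hv.1.2.trans htT
  rw [nextTime, hleast.csInf_eq]
  exact hleast

theorem lt_nextTime {n : ℕ} (hn : 2 ≤ n) {a : Fin n → Fin n → ℝ → ℝ}
    (ha : IsWeights a) (hconn : PersistentConnectivity a) {s : ℝ} (hs : 0 ≤ s) :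
    s < nextTime a s := by
  obtain ⟨hle, h1⟩ := (isLeast_nextTime hn ha hconn hs).1
  refine lt_of_le_of_ne hle fun h => ?_
  rw [← h, minInfluence_self] at h1
  exact zero_ne_one h1

theorem one_le_influence_nextTime {n : ℕ} (hn : 2 ≤ n) {a : Fin n → Fin n → ℝ → ℝ}
    (ha : IsWeights a) (hconn : PersistentConnectivity a) {s : ℝ} (hs : 0 ≤ s)
    {S : Finset (Fin n)} (hS : S.Nonempty) (hS' : S ≠ Finset.univ) :
    1 ≤ influence a S s (nextTime a s) := by
  rw [← (isLeast_nextTime hn ha hconn hs).1.2]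
  exact minInfluence_le ha hs (hs.trans (lt_nextTime hn ha hconn hs).le) hS hS'

theorem iterate_nextTime_nonneg {n : ℕ} (hn : 2 ≤ n) {a : Fin n → Fin n → ℝ → ℝ}
    (ha : IsWeights a) (hconn : PersistentConnectivity a) {s : ℝ} (hs : 0 ≤ s) (q : ℕ) :
    0 ≤ (nextTime a)^[q] s := by
  induction q with
  | zero => exact hs
  | succ q ih =>
    rw [Function.iterate_succ_apply']
    exact ih.trans (lt_nextTime hn ha hconn ih).le

theorem rescaledTime_nonneg {n : ℕ} (hn : 2 ≤ n) {a : Fin n → Fin n → ℝ → ℝ}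
    (ha : IsWeights a) (hconn : PersistentConnectivity a) (p : ℕ) : 0 ≤ rescaledTime a p := by
  induction p with
  | zero => exact le_rfl
  | succ p ih => exact iterate_nextTime_nonneg hn ha hconn ih _

theorem intermediateTime_nonneg {n : ℕ} (hn : 2 ≤ n) {a : Fin n → Fin n → ℝ → ℝ}
    (ha : IsWeights a) (hconn : PersistentConnectivity a) (p q : ℕ) :
    0 ≤ intermediateTime a p q :=
  iterate_nextTime_nonneg hn ha hconn (rescaledTime_nonneg hn ha hconn p) q

theorem intermediateTime_succ {n : ℕ} (a : Fin n → Fin n → ℝ → ℝ) (p q : ℕ) :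
    intermediateTime a p (q + 1) = nextTime a (intermediateTime a p q) :=
  Function.iterate_succ_apply' _ _ _

theorem intermediateTime_strictMono {n : ℕ} (hn : 2 ≤ n) {a : Fin n → Fin n → ℝ → ℝ}
    (ha : IsWeights a) (hconn : PersistentConnectivity a) (p : ℕ) :
    StrictMono (intermediateTime a p) := by
  refine strictMono_nat_of_lt_succ fun q => ?_
  rw [intermediateTime_succ]
  exact lt_nextTime hn ha hconn (intermediateTime_nonneg hn ha hconn p q)

theorem rescaledTime_strictMono {n : ℕ} (hn : 2 ≤ n) {a : Fin n → Fin n → ℝ → ℝ}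
    (ha : IsWeights a) (hconn : PersistentConnectivity a) : StrictMono (rescaledTime a) :=
  strictMono_nat_of_lt_succ fun p =>
    intermediateTime_strictMono hn ha hconn p (show 0 < n / 2 by omega)

/-- This excludes accumulation of the times `t_p`: the influence over a bounded interval is finite.
-/
theorem natCast_le_influence {n : ℕ} (hn : 2 ≤ n) {a : Fin n → Fin n → ℝ → ℝ}
    (ha : IsWeights a) (hconn : PersistentConnectivity a) {S : Finset (Fin n)} (hS : S.Nonempty)
    (hS' : S ≠ Finset.univ) (p : ℕ) : (p : ℝ) ≤ influence a S 0 (rescaledTime a p) := by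
  induction p with
  | zero => simp [rescaledTime, influence]
  | succ p ih =>
    have h0 := rescaledTime_nonneg hn ha hconn p
    have h1 := one_le_influence_nextTime hn ha hconn h0 hS hS'
    have h2 : nextTime a (rescaledTime a p) ≤ rescaledTime a (p + 1) :=
      (intermediateTime_strictMono hn ha hconn p).monotone (show 1 ≤ n / 2 by omega)
    have h3 := influence_mono ha S h0 (lt_nextTime hn ha hconn h0).le h2
    rw [← influence_add ha S le_rfl h0 (rescaledTime_nonneg hn ha hconn (p + 1))]
    push_cast
    linarith

theorem exists_lt_rescaledTime {n : ℕ} (hn : 2 ≤ n) {a : Fin n → Fin n → ℝ → ℝ}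
    (ha : IsWeights a) (hconn : PersistentConnectivity a) (t : ℝ) :
    ∃ p, t < rescaledTime a p := by
  by_contra! h
  obtain ⟨S, hS, hS'⟩ := nonempty_properSubset hn
  obtain ⟨p, hp⟩ := exists_nat_gt (influence a S 0 t)
  have h1 := natCast_le_influence hn ha hconn hS hS' p
  have h2 := influence_mono ha S le_rfl (rescaledTime_nonneg hn ha hconn p) (h p)
  linarith

theorem exists_unique_period {n : ℕ} (hn : 2 ≤ n) {a : Fin n → Fin n → ℝ → ℝ}
    (ha : IsWeights a) (hconn : PersistentConnectivity a) {t : ℝ} (ht : 0 ≤ t) :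
    ∃ P : ℕ, ∀ p, P = p ↔ t ∈ Ico (rescaledTime a p) (rescaledTime a (p + 1)) := by
  classical
  have hmono := rescaledTime_strictMono hn ha hconn
  have hex : ∃ p, t < rescaledTime a (p + 1) := by
    obtain ⟨p, hp⟩ := exists_lt_rescaledTime hn ha hconn t
    exact ⟨p, hp.trans (hmono p.lt_succ_self)⟩
  have hP : t ∈ Ico (rescaledTime a (Nat.find hex)) (rescaledTime a (Nat.find hex + 1)) := by
    refine ⟨?_, Nat.find_spec hex⟩
    rcases h : Nat.find hex with _ | q
    · exact ht
    · exact not_lt.1 (Nat.find_min hex (m := q) (by omega))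
  refine ⟨Nat.find hex, fun p => ⟨fun h => h ▸ hP, fun hp => ?_⟩⟩
  have h1 := hmono.lt_iff_lt.1 (hp.1.trans_lt hP.2)
  have h2 := hmono.lt_iff_lt.1 (hP.1.trans_lt hp.2)
  omega

/-! ### Convergence -/

theorem contraction_factor_mem {n : ℕ} (hn : 2 ≤ n) {K : ℝ} (hK : 1 ≤ K) :
    1 - 1 / (8 * K * (n : ℝ) ^ 2) ^ (n / 2) ∈ Ico (0 : ℝ) 1 := by
  have hnR : (2 : ℝ) ≤ n := by exact_mod_cast hn
  have h1 : 1 ≤ (8 * K * (n : ℝ) ^ 2) ^ (n / 2) := one_le_pow₀ (by nlinarith)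
  have h2 := (div_le_one (by linarith)).2 h1
  have h3 : 0 < 1 / (8 * K * (n : ℝ) ^ 2) ^ (n / 2) := one_div_pos.2 (by linarith)
  constructor <;> linarith

theorem IsTrajectory.diameter_rescaledTime_le {n : ℕ} (hn : 2 ≤ n) {a : Fin n → Fin n → ℝ → ℝ}
    (ha : IsWeights a) (hconn : PersistentConnectivity a) {K : ℝ} (hK : 1 ≤ K)
    (hcut : CutBalanced a K) {x : Fin n → ℝ → ℝ} (hx : IsTrajectory a x) (p : ℕ) :
    diameter x (rescaledTime a p) ≤
      (1 - 1 / (8 * K * (n : ℝ) ^ 2) ^ (n / 2)) ^ p * diameter x 0 := by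
  induction p with
  | zero => simp [rescaledTime]
  | succ p ih =>
    have h := hx.diameter_contraction hn ha hK hcut (τ := intermediateTime a p)
      (intermediateTime_nonneg hn ha hconn p 0)
      (intermediateTime_strictMono hn ha hconn p).monotone fun q _ S hS hS' => by
        rw [intermediateTime_succ]
        exact one_le_influence_nextTime hn ha hconn (intermediateTime_nonneg hn ha hconn p q) hS hS'
    refine h.trans ((mul_le_mul_of_nonneg_left ih (contraction_factor_mem hn hK).1).trans
      (le_of_eq ?_))
    rw [pow_succ]
    ring

/-- A trajectory whose diameter vanishes asymptotically reaches a consensus. -/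
theorem IsTrajectory.reachesConsensus_of_diameter {n : ℕ} (hn : 0 < n)
    {a : Fin n → Fin n → ℝ → ℝ} (ha : IsWeights a) {x : Fin n → ℝ → ℝ} (hx : IsTrajectory a x)
    (h : Tendsto (diameter x) atTop (𝓝 0)) : ReachesConsensus x := by
  have hne : Nonempty (Fin n) := ⟨⟨0, hn⟩⟩
  -- Both are compared with one agent's position at the later of the two times.
  have hcross : ∀ s, 0 ≤ s → ∀ t, 0 ≤ t → (⨅ j, x j s) ≤ ⨆ j, x j t := fun s hs t ht =>
    (hx.lower_bound ha hs (le_max_left s t) (iInf_le_pos x s) hne.some).trans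
      (hx.upper_bound ha ht (le_max_right s t) (pos_le_iSup x t) hne.some)
  set c := sSup ((fun s => ⨅ j, x j s) '' Ici 0) with hc
  have hlow : ∀ t, 0 ≤ t → (⨅ j, x j t) ≤ c := fun t ht =>
    le_csSup ⟨⨆ j, x j 0, by rintro _ ⟨s, hs, rfl⟩; exact hcross s hs 0 le_rfl⟩ ⟨t, ht, rfl⟩
  have hup : ∀ t, 0 ≤ t → c ≤ ⨆ j, x j t := fun t ht =>
    csSup_le ⟨_, 0, self_mem_Ici, rfl⟩ (by rintro _ ⟨s, hs, rfl⟩; exact hcross s hs t ht)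
  refine ⟨c, fun i => ?_⟩
  rw [tendsto_iff_dist_tendsto_zero]
  refine squeeze_zero' (Eventually.of_forall fun _ => dist_nonneg) ?_ h
  filter_upwards [eventually_ge_atTop 0] with t ht
  have h1 := iInf_le_pos x t i
  have h2 := pos_le_iSup x t i
  have h3 := hlow t ht
  have h4 := hup t ht
  rw [Real.dist_eq, abs_le]
  unfold diameter
  constructor <;> linarith

end Consensus

end

theorem mainTheorem3 {n : ℕ} (hn : 2 ≤ n) (a : Fin n → Fin n → ℝ → ℝ)
    (ha : Consensus.IsWeights a) (hconn : Consensus.PersistentConnectivity a)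
    (K : ℝ) (hK : 1 ≤ K) (hcut : Consensus.CutBalanced a K) :
    (∀ p q : ℕ, q < n / 2 →
      IsLeast (Consensus.unitTimes a (Consensus.intermediateTime a p q))
        (Consensus.intermediateTime a p (q + 1))) ∧
    ∃ P : ℝ → ℕ,
      (∀ t : ℝ, 0 ≤ t → ∀ p : ℕ,
        (P t = p ↔ t ∈ Set.Ico (Consensus.rescaledTime a p) (Consensus.rescaledTime a (p + 1)))) ∧
      ∀ x : Fin n → ℝ → ℝ, Consensus.IsTrajectory a x →
        (∀ t : ℝ, 0 ≤ t →
          Consensus.diameter x t ≤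
            (1 - 1 / (8 * K * (n : ℝ) ^ 2) ^ (n / 2)) ^ P t * Consensus.diameter x 0) ∧
        Consensus.ReachesConsensus x := by
  refine ⟨fun p q _ => ?_, ?_⟩
  · rw [Consensus.intermediateTime_succ]
    exact Consensus.isLeast_nextTime hn ha hconn
      (Consensus.intermediateTime_nonneg hn ha hconn p q)
  -- At negative times `P` is arbitrary.
  choose! P hP using fun (t : ℝ) (ht : 0 ≤ t) => Consensus.exists_unique_period hn ha hconn ht
  refine ⟨P, hP, fun x hx => ?_⟩
  have hn0 : 0 < n := by omega
  have hbound : ∀ t : ℝ, 0 ≤ t → Consensus.diameter x t ≤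
      (1 - 1 / (8 * K * (n : ℝ) ^ 2) ^ (n / 2)) ^ P t * Consensus.diameter x 0 := fun t ht =>
    (hx.diameter_antitone hn0 ha (Consensus.rescaledTime_nonneg hn ha hconn _)
      ((hP t ht _).1 rfl).1).trans (hx.diameter_rescaledTime_le hn ha hconn hK hcut _)
  refine ⟨hbound, hx.reachesConsensus_of_diameter hn0 ha ?_⟩
  have hPtop : Tendsto P atTop atTop := by
    refine tendsto_atTop.2 fun p => ?_
    filter_upwards [eventually_ge_atTop (Consensus.rescaledTime a p)] with t ht
    have h := (hP t ((Consensus.rescaledTime_nonneg hn ha hconn p).trans ht) _).1 rfl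
    exact Nat.lt_succ_iff.1
      ((Consensus.rescaledTime_strictMono hn ha hconn).lt_iff_lt.1 (ht.trans_lt h.2))
  obtain ⟨h0, h1⟩ := Consensus.contraction_factor_mem hn hK
  have hlim := ((tendsto_pow_atTop_nhds_zero_of_lt_one h0 h1).comp hPtop).mul_const
    (Consensus.diameter x 0)
  rw [zero_mul] at hlim
  refine squeeze_zero' (Eventually.of_forall fun t => Consensus.diameter_nonneg hn0 x t) ?_ hlim
  filter_upwards [eventually_ge_atTop 0] with t ht
  exact hbound t ht
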